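/- Let $\theta\mapsto\rho(\theta)$ be a two-parameter family of density matrices on $\mathbb C^D$ whose value $\rho$ at a given point has full rank, and let $\rho_1=\partial_1\rho$, $\rho_2=\partial_2\rho$ be its partial derivatives there; put $\rho_0=\rho$. The Holevo Cramér–Rao bound (with identity weight matrix) is $$C_{\mathsf H}=\min_{X_1,X_2}\ \operatorname{Tr}\bigl(\operatorname{Re}Z(X)\bigr)+\|\operatorname{Im}Z(X)\|_1,\qquad Z(X)_{jk}=\operatorname{Tr}(\rho X_jX_k),$$ over Hermitian $X_1,X_2$ with $\operatorname{Tr}(\rho X_j)=0$ and $\operatorname{Tr}(\rho_jX_k)=\delta_{jk}$. Let $\rho=\sum_jp_j|e_j\rangle\langle e_j|$ be a spectral decomposition. For $0<u<1$ and $l=0,1,2$ put $$\gamma_{l+1}=-\sum_{j,k}\frac{\langle e_j|\rho_l/2|e_k\rangle}{u p_k+(1-u)p_j}\,|e_j\rangle\langle e_k| ,$$ let $G_1,G_2,G_3$ be the $3\times3$ matrices with entries $\operatorname{Tr}(\gamma_{j}\rho\gamma_{k}^\dagger)$, $\operatorname{Tr}(\gamma_{j}^\dagger\rho\gamma_{k})$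 and $\operatorname{Tr}(\rho_{j-1}\gamma_{k})$ ($j,k=1,2,3$), let $$\mathcal Q_1=\begin{pmatrix}G_1&-iG_1\\ iG_1&G_1\end{pmatrix},\quad \mathcal Q_2=\begin{pmatrix}G_2&iG_2\\-iG_2&G_2\end{pmatrix},\quad \mathcal Q_3=\frac12\begin{pmatrix}G_3+G_3^*&i(G_3-G_3^*)\\-i(G_3-G_3^*)&G_3+G_3^*\end{pmatrix}$$ ($G_3^*$ being the entrywise complex conjugate), and let $\mathcal Q=u\operatorname{Re}\mathcal Q_1+(1-u)\operatorname{Re}\mathcal Q_2+\operatorname{Re}\mathcal Q_3$ and $b=(0,1,0,0,0,1)^\top$. Suppose that $0<u<1$ and that $\mathcal Q$ is negative definite (hence of full rank) at $u$. Then: (a) For every $z\in\mathbb R^6$, with $A=\frac12\sum_{l=0}^2(z_{l+1}-iz_{l+4})\rho_l$, the Sylvester equation $uY\rho+(1-u)\rho Y=-A^\dagger$ has exactly one solution, $Y=\sum_{l=0}^2(z_{l+1}+iz_{l+4})\gamma_{l+1}$. (b) The minimum defining $C_{\mathsf H}$ is attained, and $\mathscr L_u\le C_{\mathsf H}\le\mathscr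 U_u$, where $$\mathscr L_u=-\tfrac14\,b^\top\mathcal Q^{-1}b,\qquad \mathscr U_u=\tfrac14\max\bigl\{b^\top\mathcal Q^{-1}\mathcal Q_1\mathcal Q^{-1}b,\ b^\top\mathcal Q^{-1}\mathcal Q_2\mathcal Q^{-1}b\bigr\}.$$ (c) $\mathcal Q$ and $\mathscr L_u$ are differentiable in $u$, with $\frac{d}{du}\mathscr L_u=\frac14\,b^\top\mathcal Q^{-1}\frac{d\mathcal Q}{du}\mathcal Q^{-1}b$. If this derivative vanishes at $u$, then $\mathscr L_u=C_{\mathsf H}=\mathscr U_u$. In that case, with $z=\frac12\mathcal Q^{-1}b$ and $\varrho^{(s)}=\sum_{l=0}^2z_{l+s}\rho_l$, the matrices $X_1,X_2$ with elements in the eigenbasis $(e_j)$ $$[X_1]_{jk}=\frac{i(p_j-p_k)(1-2u)[\varrho^{(4)}]_{jk}-(p_j+p_k)[\varrho^{(1)}]_{jk}}{4(up_k+(1-u)p_j)(up_j+(1-u)p_k)},$$ $$[X_2]_{jk}=-\frac{i(p_j-p_k)(1-2u)[\varrho^{(1)}]_{jk}+(p_j+p_k)[\varrho^{(4)}]_{jk}}{4(up_k+(1-u)p_j)(up_j+(1-u)p_k)}$$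 are Hermitian, satisfy the constraints and attain the minimum $C_{\mathsf H}$; moreover $X_1+iX_2$ is the solution $Y$ in (a) for this $z$. -/

import Mathlib

open Matrix Topology
open scoped ComplexOrder

namespace HCRB

noncomputable section

/-! ## Statistical models and the Holevo Cramer-Rao bound (identity weight matrix) -/

/-- A density matrix on `ℂ^D`: positive semidefinite with unit trace. -/
def IsDensityMatrix {D : ℕ} (ρ : Matrix (Fin D) (Fin D) ℂ) : Prop :=
  ρ.PosSemidef ∧ ρ.trace = 1

/-- `M` is the partial derivative `∂_j ρ` at `θ` of the family `θ ↦ ρ(θ)` (entry by entry). -/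
def HasPartialDerivAt {D d : ℕ} (ρ : (Fin d → ℝ) → Matrix (Fin D) (Fin D) ℂ) (j : Fin d)
    (M : Matrix (Fin D) (Fin D) ℂ) (θ : Fin d → ℝ) : Prop :=
  ∀ a b, HasDerivAt (fun t : ℝ => ρ (Function.update θ j t) a b) (M a b) (θ j)

/-- The constraints of the Holevo minimisation: `X_1, …, X_d` are Hermitian,
`Tr(ρ X_j) = 0` and `Tr(∂_jρ X_k) = δ_{jk}`. -/
def LocallyUnbiased {D d : ℕ} (ρ : Matrix (Fin D) (Fin D) ℂ)
    (ρ' : Fin d → Matrix (Fin D) (Fin D) ℂ) (X : Fin d → Matrix (Fin D) (Fin D) ℂ) : Prop :=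
  (∀ j, (X j).IsHermitian) ∧ (∀ j, (ρ * X j).trace = 0) ∧
    ∀ j k, (ρ' j * X k).trace = if j = k then 1 else 0

/-- The matrix `Z(X)`, with entries `Tr(ρ X_j X_k)`. -/
def Zmat {D d : ℕ} (ρ : Matrix (Fin D) (Fin D) ℂ)
    (X : Fin d → Matrix (Fin D) (Fin D) ℂ) : Matrix (Fin d) (Fin d) ℂ :=
  Matrix.of fun j k => (ρ * X j * X k).trace

/-- The trace norm of a real square matrix: the sum of its singular values, i.e. of the square
roots of the eigenvalues of `Mᵀ M`. -/
def traceNorm {d : ℕ} (M : Matrix (Fin d) (Fin d) ℝ) : ℝ :=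
  ∑ i, √((isHermitian_conjTranspose_mul_self M).eigenvalues i)

/-- The objective `Tr(Re Z(X)) + ‖Im Z(X)‖₁` (weight matrix `W = 1`). -/
def holevoCost {D d : ℕ} (ρ : Matrix (Fin D) (Fin D) ℂ)
    (X : Fin d → Matrix (Fin D) (Fin D) ℂ) : ℝ :=
  ((Zmat ρ X).map Complex.re).trace + traceNorm ((Zmat ρ X).map Complex.im)

/-- The values of the objective on the feasible observables. -/
def holevoValues {D d : ℕ} (ρ : Matrix (Fin D) (Fin D) ℂ)
    (ρ' : Fin d → Matrix (Fin D) (Fin D) ℂ) : Set ℝ :=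
  holevoCost ρ '' {X | LocallyUnbiased ρ ρ' X}

/-- The Holevo Cramer-Rao bound `C_H`: the optimal value of the minimisation. -/
def holevoBound {D d : ℕ} (ρ : Matrix (Fin D) (Fin D) ℂ)
    (ρ' : Fin d → Matrix (Fin D) (Fin D) ℂ) : ℝ :=
  sInf (holevoValues ρ ρ')

/-! ## The two-parameter matrices

`U` is a unitary matrix whose columns `e_j` are eigenvectors of `ρ`, with eigenvalues `p_j`, so that
`⟨e_j|M|e_k⟩ = (Uᴴ * M * U) j k` and `∑_{jk} c_{jk} |e_j⟩⟨e_k| = U * c * Uᴴ`.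
`R = (ρ, ∂₁ρ, ∂₂ρ)` is indexed by `Fin 3`. Vectors of the six multipliers `z_1, …, z_6` are indexed
by `Fin 3 ⊕ Fin 3`: `z_1, z_2, z_3` on the left, `z_4, z_5, z_6` on the right. -/

/-- The triple `(ρ, ∂₁ρ, ∂₂ρ)`. -/
def triple {D : ℕ} (ρ : Matrix (Fin D) (Fin D) ℂ) (ρ' : Fin 2 → Matrix (Fin D) (Fin D) ℂ) :
    Fin 3 → Matrix (Fin D) (Fin D) ℂ :=
  ![ρ, ρ' 0, ρ' 1]

/-- `A = ½ ∑_l (z_{l+1} - i z_{l+4}) ρ_l`, where `(ρ_0, ρ_1, ρ_2) = (ρ, ∂₁ρ, ∂₂ρ)`. -/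
def lagrangeA {D : ℕ} (R : Fin 3 → Matrix (Fin D) (Fin D) ℂ) (z : Fin 3 ⊕ Fin 3 → ℝ) :
    Matrix (Fin D) (Fin D) ℂ :=
  ∑ l, (((z (.inl l) : ℂ) - Complex.I * (z (.inr l) : ℂ)) / 2) • R l

/-- `γ_{l+1} = -∑_{jk} (u p_k + (1-u) p_j)⁻¹ ⟨e_j|ρ_l/2|e_k⟩ |e_j⟩⟨e_k|`, for `l = 0, 1, 2`
(for `l = 0` this is `-1/2` times the identity). -/
def gam {D : ℕ} (R : Fin 3 → Matrix (Fin D) (Fin D) ℂ) (U : Matrix (Fin D) (Fin D) ℂ)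
    (p : Fin D → ℝ) (u : ℝ) (l : Fin 3) : Matrix (Fin D) (Fin D) ℂ :=
  -(U * (Matrix.of fun j k =>
      ((u * p k + (1 - u) * p j : ℝ) : ℂ)⁻¹ * ((Uᴴ * R l * U) j k / 2)) * Uᴴ)

/-- `Y = ∑_l (z_{l+1} + i z_{l+4}) γ_{l+1}`. -/
def solY {D : ℕ} (R : Fin 3 → Matrix (Fin D) (Fin D) ℂ) (U : Matrix (Fin D) (Fin D) ℂ)
    (p : Fin D → ℝ) (u : ℝ) (z : Fin 3 ⊕ Fin 3 → ℝ) : Matrix (Fin D) (Fin D) ℂ :=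
  ∑ l, ((z (.inl l) : ℂ) + Complex.I * (z (.inr l) : ℂ)) • gam R U p u l

/-- `G_1`, with entries `Tr(γ_j ρ γ_k†)`. -/
def G1 {D : ℕ} (R : Fin 3 → Matrix (Fin D) (Fin D) ℂ) (U : Matrix (Fin D) (Fin D) ℂ)
    (p : Fin D → ℝ) (u : ℝ) : Matrix (Fin 3) (Fin 3) ℂ :=
  Matrix.of fun j k => (gam R U p u j * R 0 * (gam R U p u k)ᴴ).trace

/-- `G_2`, with entries `Tr(γ_j† ρ γ_k)`. -/
def G2 {D : ℕ} (R : Fin 3 → Matrix (Fin D) (Fin D) ℂ) (U : Matrix (Fin D) (Fin D) ℂ)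
    (p : Fin D → ℝ) (u : ℝ) : Matrix (Fin 3) (Fin 3) ℂ :=
  Matrix.of fun j k => ((gam R U p u j)ᴴ * R 0 * gam R U p u k).trace

/-- `G_3`, with entries `Tr(ρ_j γ_k)`. -/
def G3 {D : ℕ} (R : Fin 3 → Matrix (Fin D) (Fin D) ℂ) (U : Matrix (Fin D) (Fin D) ℂ)
    (p : Fin D → ℝ) (u : ℝ) : Matrix (Fin 3) (Fin 3) ℂ :=
  Matrix.of fun j k => (R j * gam R U p u k).trace

/-- `𝒬₁` in `2 × 2` blocks. -/
def Q1 {D : ℕ} (R : Fin 3 → Matrix (Fin D) (Fin D) ℂ) (U : Matrix (Fin D) (Fin D) ℂ)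
    (p : Fin D → ℝ) (u : ℝ) : Matrix (Fin 3 ⊕ Fin 3) (Fin 3 ⊕ Fin 3) ℂ :=
  Matrix.fromBlocks (G1 R U p u) (-Complex.I • G1 R U p u) (Complex.I • G1 R U p u) (G1 R U p u)

/-- `𝒬₂` in `2 × 2` blocks. -/
def Q2 {D : ℕ} (R : Fin 3 → Matrix (Fin D) (Fin D) ℂ) (U : Matrix (Fin D) (Fin D) ℂ)
    (p : Fin D → ℝ) (u : ℝ) : Matrix (Fin 3 ⊕ Fin 3) (Fin 3 ⊕ Fin 3) ℂ :=
  Matrix.fromBlocks (G2 R U p u) (Complex.I • G2 R U p u) (-Complex.I • G2 R U p u) (G2 R U p u)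

/-- `𝒬₃` in `2 × 2` blocks; `G_3^*` is the entrywise complex conjugate. -/
def Q3 {D : ℕ} (R : Fin 3 → Matrix (Fin D) (Fin D) ℂ) (U : Matrix (Fin D) (Fin D) ℂ)
    (p : Fin D → ℝ) (u : ℝ) : Matrix (Fin 3 ⊕ Fin 3) (Fin 3 ⊕ Fin 3) ℂ :=
  (1 / 2 : ℂ) • Matrix.fromBlocks
    (G3 R U p u + (G3 R U p u).map star)
    (Complex.I • (G3 R U p u - (G3 R U p u).map star))
    (-Complex.I • (G3 R U p u - (G3 R U p u).map star))
    (G3 R U p u + (G3 R U p u).map star)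

/-- `𝒬 = u Re 𝒬₁ + (1-u) Re 𝒬₂ + Re 𝒬₃`; the `𝒬ᵢ` depend on `u` as well. -/
def calQ {D : ℕ} (R : Fin 3 → Matrix (Fin D) (Fin D) ℂ) (U : Matrix (Fin D) (Fin D) ℂ)
    (p : Fin D → ℝ) (u : ℝ) : Matrix (Fin 3 ⊕ Fin 3) (Fin 3 ⊕ Fin 3) ℝ :=
  u • (Q1 R U p u).map Complex.re + (1 - u) • (Q2 R U p u).map Complex.re
    + (Q3 R U p u).map Complex.re

/-- The entrywise derivative of `𝒬` with respect to `u`. -/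
def calQderiv {D : ℕ} (R : Fin 3 → Matrix (Fin D) (Fin D) ℂ) (U : Matrix (Fin D) (Fin D) ℂ)
    (p : Fin D → ℝ) (u : ℝ) : Matrix (Fin 3 ⊕ Fin 3) (Fin 3 ⊕ Fin 3) ℝ :=
  Matrix.of fun i j => deriv (fun s => calQ R U p s i j) u

/-- `b = (0, 1, 0, 0, 0, 1)ᵀ`. -/
def bvec : Fin 3 ⊕ Fin 3 → ℝ := Sum.elim ![0, 1, 0] ![0, 0, 1]

/-- `𝓛_u = -¼ bᵀ 𝒬⁻¹ b`. -/
def lowerBound {D : ℕ} (R : Fin 3 → Matrix (Fin D) (Fin D) ℂ) (U : Matrix (Fin D) (Fin D) ℂ)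
    (p : Fin D → ℝ) (u : ℝ) : ℝ :=
  -(1 / 4) * (bvec ⬝ᵥ ((calQ R U p u)⁻¹ *ᵥ bvec))

/-- `𝓤_u = ¼ max {bᵀ 𝒬⁻¹ 𝒬₁ 𝒬⁻¹ b, bᵀ 𝒬⁻¹ 𝒬₂ 𝒬⁻¹ b}`. The two numbers are real, as `𝒬₁` and `𝒬₂`
are Hermitian and `𝒬` is real symmetric; so they are computed with the real parts. -/
def upperBound {D : ℕ} (R : Fin 3 → Matrix (Fin D) (Fin D) ℂ) (U : Matrix (Fin D) (Fin D) ℂ)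
    (p : Fin D → ℝ) (u : ℝ) : ℝ :=
  1 / 4 * max
    (bvec ⬝ᵥ (((calQ R U p u)⁻¹ * (Q1 R U p u).map Complex.re * (calQ R U p u)⁻¹) *ᵥ bvec))
    (bvec ⬝ᵥ (((calQ R U p u)⁻¹ * (Q2 R U p u).map Complex.re * (calQ R U p u)⁻¹) *ᵥ bvec))

/-- The multipliers `z = ½ 𝒬⁻¹ b`. -/
def optZ {D : ℕ} (R : Fin 3 → Matrix (Fin D) (Fin D) ℂ) (U : Matrix (Fin D) (Fin D) ℂ)
    (p : Fin D → ℝ) (u : ℝ) : Fin 3 ⊕ Fin 3 → ℝ :=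
  (1 / 2 : ℝ) • ((calQ R U p u)⁻¹ *ᵥ bvec)

/-- `ϱ^{(1)} = ∑_l z_{l+1} ρ_l`, for `z = ½ 𝒬⁻¹ b`. -/
def varrho1 {D : ℕ} (R : Fin 3 → Matrix (Fin D) (Fin D) ℂ) (U : Matrix (Fin D) (Fin D) ℂ)
    (p : Fin D → ℝ) (u : ℝ) : Matrix (Fin D) (Fin D) ℂ :=
  ∑ l, (optZ R U p u (.inl l) : ℂ) • R l

/-- `ϱ^{(4)} = ∑_l z_{l+4} ρ_l`, for `z = ½ 𝒬⁻¹ b`. -/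
def varrho4 {D : ℕ} (R : Fin 3 → Matrix (Fin D) (Fin D) ℂ) (U : Matrix (Fin D) (Fin D) ℂ)
    (p : Fin D → ℝ) (u : ℝ) : Matrix (Fin D) (Fin D) ℂ :=
  ∑ l, (optZ R U p u (.inr l) : ℂ) • R l

/-- The denominator `4 (u p_k + (1-u) p_j) (u p_j + (1-u) p_k)`. -/
def denom {D : ℕ} (p : Fin D → ℝ) (u : ℝ) (j k : Fin D) : ℂ :=
  ((4 * (u * p k + (1 - u) * p j) * (u * p j + (1 - u) * p k) : ℝ) : ℂ)

/-- The observable `X_1`, given by its matrix elements in the eigenbasis of `ρ`. -/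
def obs1 {D : ℕ} (R : Fin 3 → Matrix (Fin D) (Fin D) ℂ) (U : Matrix (Fin D) (Fin D) ℂ)
    (p : Fin D → ℝ) (u : ℝ) : Matrix (Fin D) (Fin D) ℂ :=
  U * (Matrix.of fun j k =>
    (Complex.I * (((p j - p k) * (1 - 2 * u) : ℝ) : ℂ) * (Uᴴ * varrho4 R U p u * U) j k
      - ((p j + p k : ℝ) : ℂ) * (Uᴴ * varrho1 R U p u * U) j k) / denom p u j k) * Uᴴ

/-- The observable `X_2`, given by its matrix elements in the eigenbasis of `ρ`. -/
def obs2 {D : ℕ} (R : Fin 3 → Matrix (Fin D) (Fin D) ℂ) (U : Matrix (Fin D) (Fin D) ℂ)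
    (p : Fin D → ℝ) (u : ℝ) : Matrix (Fin D) (Fin D) ℂ :=
  U * (Matrix.of fun j k =>
    -((Complex.I * (((p j - p k) * (1 - 2 * u) : ℝ) : ℂ) * (Uᴴ * varrho1 R U p u * U) j k
      + ((p j + p k : ℝ) : ℂ) * (Uᴴ * varrho4 R U p u * U) j k) / denom p u j k)) * Uᴴ

end

end HCRB

/-!
Put `Y = X₁ + i X₂`. Over Hermitian `X₁`, `X₂` this is an arbitrary matrix, the objective becomes
`max (Tr(Y ρ Y†)) (Tr(Y† ρ Y))` (`holevoCost_eq_max`), and the constraints become six real linear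
equations `constraintVec Y = b` (`locallyUnbiased_iff`). Replacing the maximum by the weighted mean
`f_u(Y) = u Tr(Y ρ Y†) + (1 - u) Tr(Y† ρ Y)` gives a positive quadratic problem, whose stationarity
condition is the Sylvester equation. That equation is diagonal in the eigenbasis of `ρ`
(`sylvester_iff`), and its solutions are the matrices `Y(z)`, linear in the multipliers `z`.

Testing the Sylvester equation against any `W` shows that the bilinear form of `f_u` satisfies
`f_u(Y(z), W) = -½ z · constraintVec W` (`weightedForm_of_sylvester`). With `W = Y(w)` this says
that the quadratic part of `𝒬` is `-½ Re 𝒬₃`, hence `𝒬 w = ½ constraintVec (Y(w))`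
(`SpectralData.calQ_mulVec`), and so `z = ½ 𝒬⁻¹ b` makes `Y(z)` feasible. It then minimises `f_u`
among feasible matrices, with value `𝓛_u` (`SpectralData.lowerBound_le_weightedForm`), while the
objective at `Y(z)` is `𝓤_u` (`upperBound_eq`). This sandwiches `C_H`, and the minimum is attained
because the objective is continuous and coercive on a closed feasible set (`isLeast_holevoBound`).

For the stationary case, fix the optimiser `Y` at `u`. The affine function `s ↦ f_s(Y)` dominates
`𝓛_s` near `u` and touches it at `u`, so that `d𝓛/du = Tr(Y ρ Y†) - Tr(Y† ρ Y)`. If this vanishes,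
the maximum and the weighted mean at `Y` coincide (`SpectralData.trace_eq_of_deriv_eq_zero`), and
the two bounds meet at `C_H`.
-/

namespace HCRB

/-! ### The Sylvester equation in the eigenbasis -/

section Eigenbasis
variable {D : ℕ} {ρ U : Matrix (Fin D) (Fin D) ℂ} {p : Fin D → ℝ}
  {R : Fin 3 → Matrix (Fin D) (Fin D) ℂ} {u : ℝ}

theorem eq_iff_eigenbasis (hU : U ∈ Matrix.unitaryGroup (Fin D) ℂ)
    (M N : Matrix (Fin D) (Fin D) ℂ) :
    M = N ↔ ∀ j k, (Uᴴ * M * U) j k = (Uᴴ * N * U) j k := by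
  have h : U * Uᴴ = 1 := mem_unitaryGroup_iff.1 hU
  have key : ∀ M : Matrix (Fin D) (Fin D) ℂ, U * (Uᴴ * M * U) * Uᴴ = M := fun M => by
    calc U * (Uᴴ * M * U) * Uᴴ = (U * Uᴴ) * M * (U * Uᴴ) := by noncomm_ring
      _ = M := by simp [h]
  refine ⟨fun e j k => by rw [e], fun e => ?_⟩
  have : Uᴴ * M * U = Uᴴ * N * U := by ext j k; exact e j k
  rw [← key M, ← key N, this]

theorem conj_unconj (hU : U ∈ Matrix.unitaryGroup (Fin D) ℂ) (M : Matrix (Fin D) (Fin D) ℂ) :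
    Uᴴ * (U * M * Uᴴ) * U = M := by
  have h : Uᴴ * U = 1 := mem_unitaryGroup_iff'.1 hU
  calc Uᴴ * (U * M * Uᴴ) * U = (Uᴴ * U) * M * (Uᴴ * U) := by noncomm_ring
    _ = M := by simp [h]

theorem eigenvalue_pos (hU : U ∈ Matrix.unitaryGroup (Fin D) ℂ)
    (hspec : ρ = U * diagonal (fun j => (p j : ℂ)) * Uᴴ) (hfull : ρ.PosDef) (j : Fin D) :
    0 < p j := by
  have hinj : Function.Injective U.mulVec :=
    Matrix.mulVec_injective_of_isUnit ⟨⟨U, Uᴴ, mem_unitaryGroup_iff.1 hU,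
      mem_unitaryGroup_iff'.1 hU⟩, rfl⟩
  have h := hfull.conjTranspose_mul_mul_same hinj
  rw [hspec, conj_unconj hU, posDef_diagonal_iff] at h
  exact_mod_cast h j

theorem weight_pos (hp : ∀ j, 0 < p j) (hu0 : 0 < u) (hu1 : u < 1) (j k : Fin D) :
    0 < u * p k + (1 - u) * p j :=
  add_pos (mul_pos hu0 (hp k)) (mul_pos (sub_pos.2 hu1) (hp j))

/-- In the eigenbasis of `ρ` the Sylvester operator `Y ↦ u Y ρ + (1 - u) ρ Y` is diagonal. -/
theorem sylvester_eigenbasis (hU : U ∈ Matrix.unitaryGroup (Fin D) ℂ)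
    (hspec : ρ = U * diagonal (fun j => (p j : ℂ)) * Uᴴ) (Y : Matrix (Fin D) (Fin D) ℂ)
    (j k : Fin D) :
    (Uᴴ * ((u : ℂ) • (Y * ρ) + ((1 - u : ℝ) : ℂ) • (ρ * Y)) * U) j k =
      ((u * p k + (1 - u) * p j : ℝ) : ℂ) * (Uᴴ * Y * U) j k := by
  have h : Uᴴ * U = 1 := mem_unitaryGroup_iff'.1 hU
  have h1 : Uᴴ * (Y * ρ) * U = (Uᴴ * Y * U) * diagonal (fun j => (p j : ℂ)) := by
    rw [hspec]
    calc _ = (Uᴴ * Y * U) * diagonal (fun j => (p j : ℂ)) * (Uᴴ * U) := by noncomm_ring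
      _ = _ := by rw [h, mul_one]
  have h2 : Uᴴ * (ρ * Y) * U = diagonal (fun j => (p j : ℂ)) * (Uᴴ * Y * U) := by
    rw [hspec]
    calc _ = (Uᴴ * U) * diagonal (fun j => (p j : ℂ)) * (Uᴴ * Y * U) := by noncomm_ring
      _ = _ := by rw [h, one_mul]
  rw [mul_add, add_mul, mul_smul_comm, mul_smul_comm, smul_mul_assoc, smul_mul_assoc, h1, h2]
  simp only [Matrix.add_apply, Matrix.smul_apply, mul_diagonal, diagonal_mul, smul_eq_mul]
  push_cast
  ring

theorem gam_eigenbasis (hU : U ∈ Matrix.unitaryGroup (Fin D) ℂ) (l : Fin 3) (j k : Fin D) :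
    (Uᴴ * gam R U p u l * U) j k =
      -(((u * p k + (1 - u) * p j : ℝ) : ℂ)⁻¹ * ((Uᴴ * R l * U) j k / 2)) := by
  rw [gam, mul_neg, neg_mul, conj_unconj hU]
  rfl

theorem solY_eigenbasis (hU : U ∈ Matrix.unitaryGroup (Fin D) ℂ) (z : Fin 3 ⊕ Fin 3 → ℝ)
    (j k : Fin D) :
    (Uᴴ * solY R U p u z * U) j k = -(((u * p k + (1 - u) * p j : ℝ) : ℂ)⁻¹ *
      ∑ l, ((z (.inl l) : ℂ) + Complex.I * (z (.inr l) : ℂ)) / 2 * (Uᴴ * R l * U) j k) := by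
  simp only [solY, Finset.mul_sum, Finset.sum_mul, mul_smul_comm, smul_mul_assoc,
    Matrix.sum_apply, Matrix.smul_apply, gam_eigenbasis hU, ← Finset.sum_neg_distrib]
  refine Finset.sum_congr rfl fun l _ => ?_
  rw [smul_eq_mul]
  ring

theorem lagrangeA_conjTranspose (hR : ∀ l, (R l).IsHermitian) (z : Fin 3 ⊕ Fin 3 → ℝ) :
    (lagrangeA R z)ᴴ =
      ∑ l, (((z (.inl l) : ℂ) + Complex.I * (z (.inr l) : ℂ)) / 2) • R l := by
  rw [lagrangeA, conjTranspose_sum]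
  refine Finset.sum_congr rfl fun l _ => ?_
  rw [conjTranspose_smul, (hR l).eq]
  simp

theorem sylvester_iff (hU : U ∈ Matrix.unitaryGroup (Fin D) ℂ)
    (hspec : ρ = U * diagonal (fun j => (p j : ℂ)) * Uᴴ) (hp : ∀ j, 0 < p j)
    (hR : ∀ l, (R l).IsHermitian) (hu0 : 0 < u) (hu1 : u < 1)
    (z : Fin 3 ⊕ Fin 3 → ℝ) (Y : Matrix (Fin D) (Fin D) ℂ) :
    (u : ℂ) • (Y * ρ) + ((1 - u : ℝ) : ℂ) • (ρ * Y) = -(lagrangeA R z)ᴴ ↔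
      Y = solY R U p u z := by
  rw [eq_iff_eigenbasis hU, eq_iff_eigenbasis hU Y]
  refine forall₂_congr fun j k => ?_
  have hw : ((u * p k + (1 - u) * p j : ℝ) : ℂ) ≠ 0 := by
    exact_mod_cast (weight_pos hp hu0 hu1 j k).ne'
  rw [sylvester_eigenbasis hU hspec, solY_eigenbasis hU, lagrangeA_conjTranspose hR,
    mul_neg, neg_mul, Matrix.neg_apply, Finset.mul_sum, Finset.sum_mul, Matrix.sum_apply]
  simp only [mul_smul_comm, smul_mul_assoc, Matrix.smul_apply, smul_eq_mul]
  rw [← mul_neg, eq_inv_mul_iff_mul_eq₀ hw]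

end Eigenbasis

/-! ### The matrices `𝒬ᵢ` as bilinear forms in the multipliers -/

section Forms
variable {D : ℕ} {ρ U : Matrix (Fin D) (Fin D) ℂ} {p : Fin D → ℝ}
  {R : Fin 3 → Matrix (Fin D) (Fin D) ℂ} {u : ℝ}

/-- The real bilinear form `Re (u Tr(Y ρ W†) + (1 - u) Tr(Y† ρ W))`. -/
noncomputable def weightedForm (ρ : Matrix (Fin D) (Fin D) ℂ) (u : ℝ)
    (Y W : Matrix (Fin D) (Fin D) ℂ) : ℝ :=
  u * (Y * ρ * Wᴴ).trace.re + (1 - u) * (Yᴴ * ρ * W).trace.re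

/-- The six real constraint functionals `Re Tr(R l Y)` (left) and `Im Tr(R l Y)` (right). For
`Y = X₁ + i X₂` with Hermitian `X₁`, `X₂` and `R l` they are `Tr(R l X₁)` and `Tr(R l X₂)`. -/
noncomputable def constraintVec (R : Fin 3 → Matrix (Fin D) (Fin D) ℂ)
    (Y : Matrix (Fin D) (Fin D) ℂ) : Fin 3 ⊕ Fin 3 → ℝ :=
  Sum.elim (fun l => (R l * Y).trace.re) (fun l => (R l * Y).trace.im)

theorem dotProduct_Q1 (z w : Fin 3 ⊕ Fin 3 → ℝ) :
    z ⬝ᵥ ((Q1 R U p u).map Complex.re *ᵥ w) =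
      (solY R U p u z * R 0 * (solY R U p u w)ᴴ).trace.re := by
  have h : (solY R U p u z * R 0 * (solY R U p u w)ᴴ).trace =
      ∑ j, ∑ k, ((z (.inl j) : ℂ) + Complex.I * (z (.inr j) : ℂ)) *
        (((w (.inl k) : ℂ) - Complex.I * (w (.inr k) : ℂ)) * G1 R U p u j k) := by
    simp only [solY, conjTranspose_sum, Finset.sum_mul, Finset.mul_sum, trace_sum,
      conjTranspose_smul, smul_mul_assoc, mul_smul_comm, trace_smul, smul_eq_mul, G1, of_apply]
    rw [Finset.sum_comm]
    refine Finset.sum_congr rfl fun j _ => Finset.sum_congr rfl fun k _ => ?_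
    simp
    ring
  rw [h]
  simp only [dotProduct, mulVec, Q1, Fintype.sum_sum_type, map_apply, fromBlocks_apply₁₁,
    fromBlocks_apply₁₂, fromBlocks_apply₂₁, fromBlocks_apply₂₂, Complex.re_sum, mul_add,
    Finset.mul_sum, ← Finset.sum_add_distrib]
  refine Finset.sum_congr rfl fun j _ => Finset.sum_congr rfl fun k _ => ?_
  simp
  ring

theorem dotProduct_Q2 (z w : Fin 3 ⊕ Fin 3 → ℝ) :
    z ⬝ᵥ ((Q2 R U p u).map Complex.re *ᵥ w) =
      ((solY R U p u z)ᴴ * R 0 * solY R U p u w).trace.re := by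
  have h : ((solY R U p u z)ᴴ * R 0 * solY R U p u w).trace =
      ∑ j, ∑ k, ((z (.inl j) : ℂ) - Complex.I * (z (.inr j) : ℂ)) *
        (((w (.inl k) : ℂ) + Complex.I * (w (.inr k) : ℂ)) * G2 R U p u j k) := by
    simp only [solY, conjTranspose_sum, Finset.sum_mul, Finset.mul_sum, trace_sum,
      conjTranspose_smul, smul_mul_assoc, mul_smul_comm, trace_smul, smul_eq_mul, G2, of_apply]
    rw [Finset.sum_comm]
    refine Finset.sum_congr rfl fun j _ => Finset.sum_congr rfl fun k _ => ?_
    simp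
    ring
  rw [h]
  simp only [dotProduct, mulVec, Q2, Fintype.sum_sum_type, map_apply, fromBlocks_apply₁₁,
    fromBlocks_apply₁₂, fromBlocks_apply₂₁, fromBlocks_apply₂₂, Complex.re_sum, mul_add,
    Finset.mul_sum, ← Finset.sum_add_distrib]
  refine Finset.sum_congr rfl fun j _ => Finset.sum_congr rfl fun k _ => ?_
  simp
  ring

theorem Q3_mulVec (w : Fin 3 ⊕ Fin 3 → ℝ) :
    (Q3 R U p u).map Complex.re *ᵥ w = constraintVec R (solY R U p u w) := by
  have h : ∀ j, (R j * solY R U p u w).trace =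
      ∑ k, ((w (.inl k) : ℂ) + Complex.I * (w (.inr k) : ℂ)) * G3 R U p u j k := fun j => by
    simp only [solY, Finset.mul_sum, trace_sum, mul_smul_comm, trace_smul, smul_eq_mul, G3,
      of_apply]
  funext i
  rcases i with j | j
  all_goals
    simp only [mulVec, dotProduct, constraintVec, Sum.elim_inl, Sum.elim_inr, h, Q3,
      Fintype.sum_sum_type, map_apply, Matrix.smul_apply, fromBlocks_apply₁₁, fromBlocks_apply₁₂,
      fromBlocks_apply₂₁, fromBlocks_apply₂₂, Complex.re_sum, Complex.im_sum,
      ← Finset.sum_add_distrib]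
    refine Finset.sum_congr rfl fun k _ => ?_
    simp
    ring

/-- The weighted form against a solution of the Sylvester equation is a combination of the
constraint functionals. -/
theorem weightedForm_of_sylvester {z : Fin 3 ⊕ Fin 3 → ℝ} {Y : Matrix (Fin D) (Fin D) ℂ}
    (h : (u : ℂ) • (Y * ρ) + ((1 - u : ℝ) : ℂ) • (ρ * Y) = -(lagrangeA R z)ᴴ)
    (hρ : ρ.IsHermitian) (W : Matrix (Fin D) (Fin D) ℂ) :
    weightedForm ρ u Y W = -(1 / 2) * (z ⬝ᵥ constraintVec R W) := by
  have h1 : (Yᴴ * ρ * W).trace.re = (ρ * Y * Wᴴ).trace.re := by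
    have : (Yᴴ * ρ * W)ᴴ = Wᴴ * (ρ * Y) := by
      rw [conjTranspose_mul, conjTranspose_mul, conjTranspose_conjTranspose, hρ.eq]
    rw [trace_mul_comm _ Wᴴ, ← this, trace_conjTranspose]
    simp
  have h2 : weightedForm ρ u Y W =
      (((u : ℂ) • (Y * ρ) + ((1 - u : ℝ) : ℂ) • (ρ * Y)) * Wᴴ).trace.re := by
    rw [weightedForm, h1, add_mul, smul_mul_assoc, smul_mul_assoc, trace_add, trace_smul,
      trace_smul]
    simp only [smul_eq_mul, Complex.add_re, Complex.re_ofReal_mul]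
  have h3 : ((lagrangeA R z)ᴴ * Wᴴ).trace.re = (lagrangeA R z * W).trace.re := by
    rw [← conjTranspose_mul, trace_conjTranspose, trace_mul_comm]
    simp
  rw [h2, h, neg_mul, trace_neg, Complex.neg_re, h3]
  simp only [lagrangeA, Finset.sum_mul, smul_mul_assoc, trace_sum, trace_smul, dotProduct,
    Fintype.sum_sum_type, constraintVec, Sum.elim_inl, Sum.elim_inr, Complex.re_sum,
    ← Finset.sum_add_distrib, Finset.mul_sum, ← Finset.sum_neg_distrib]
  refine Finset.sum_congr rfl fun k _ => ?_
  simp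
  ring

end Forms

/-! ### The objective and the constraints in terms of `Y = X₁ + i X₂` -/

section Cost
variable {D : ℕ} {ρ : Matrix (Fin D) (Fin D) ℂ}

theorem traceNorm_of_conjTranspose_mul_self {d : ℕ} {M : Matrix (Fin d) (Fin d) ℝ} {c : ℝ}
    (h : Mᴴ * M = c ^ 2 • (1 : Matrix (Fin d) (Fin d) ℝ)) : traceNorm M = d * |c| := by
  have key : ∀ i, (isHermitian_conjTranspose_mul_self M).eigenvalues i = c ^ 2 := fun i => by
    set hM := isHermitian_conjTranspose_mul_self M
    set v := (hM.eigenvectorBasis i).ofLp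
    have h1 : (Mᴴ * M) *ᵥ v = hM.eigenvalues i • v := hM.mulVec_eigenvectorBasis i
    have h2 : (Mᴴ * M) *ᵥ v = c ^ 2 • v := by rw [h, smul_mulVec, one_mulVec]
    have h0 : v ≠ 0 := fun e =>
      hM.eigenvectorBasis.orthonormal.ne_zero i (by ext k; exact congrFun e k)
    exact smul_left_injective ℝ h0 (h1.symm.trans h2)
  rw [traceNorm, Finset.sum_congr rfl fun i _ => congrArg Real.sqrt (key i)]
  simp [Real.sqrt_sq_eq_abs]

theorem traceNorm_antisymm {M : Matrix (Fin 2) (Fin 2) ℝ} (h0 : M 0 0 = 0) (h1 : M 1 1 = 0)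
    (h : M 1 0 = -M 0 1) : traceNorm M = 2 * |M 0 1| := by
  have := traceNorm_of_conjTranspose_mul_self (M := M) (c := M 0 1) (by
    ext i j
    fin_cases i <;> fin_cases j <;> simp [mul_apply, h0, h1, h] <;> ring)
  simpa using this

/-- For `Y = X₁ + i X₂`, the objective is the larger of `Tr(Y ρ Y†)` and `Tr(Y† ρ Y)`: the two
numbers are `Tr Re Z ∓ 2 Im Z₁₂`, and `Im Z` is antisymmetric with trace norm `2 |Im Z₁₂|`. -/
theorem holevoCost_eq_max (hρ : ρ.IsHermitian) {X : Fin 2 → Matrix (Fin D) (Fin D) ℂ}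
    (hX : ∀ j, (X j).IsHermitian) :
    holevoCost ρ X = max
      ((X 0 + Complex.I • X 1) * ρ * (X 0 + Complex.I • X 1)ᴴ).trace.re
      ((X 0 + Complex.I • X 1)ᴴ * ρ * (X 0 + Complex.I • X 1)).trace.re := by
  have hZ : ∀ j k, star (Zmat ρ X j k) = Zmat ρ X k j := fun j k => by
    simp only [Zmat, of_apply]
    rw [← trace_conjTranspose, conjTranspose_mul, conjTranspose_mul, hρ.eq, (hX j).eq, (hX k).eq,
      ← mul_assoc, trace_mul_comm, ← mul_assoc]
  have him : ∀ j k, (Zmat ρ X k j).im = -(Zmat ρ X j k).im := fun j k => by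
    rw [← hZ j k]; simp
  have hc : ∀ j k, (X j * ρ * X k).trace = Zmat ρ X k j := fun j k => by
    simp only [Zmat, of_apply]
    rw [mul_assoc, trace_mul_comm]
  have hstar : (X 0 + Complex.I • X 1)ᴴ = X 0 - Complex.I • X 1 := by
    rw [conjTranspose_add, conjTranspose_smul, (hX 0).eq, (hX 1).eq]
    simp [sub_eq_add_neg]
  have h1 : ((X 0 + Complex.I • X 1) * ρ * (X 0 - Complex.I • X 1)).trace.re =
      (Zmat ρ X 0 0).re + (Zmat ρ X 1 1).re - 2 * (Zmat ρ X 0 1).im := by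
    simp only [add_mul, mul_sub, smul_mul_assoc, mul_smul_comm, trace_add, trace_sub,
      trace_smul, hc, smul_eq_mul]
    simp [him 0 1]
    ring
  have h2 : ((X 0 - Complex.I • X 1) * ρ * (X 0 + Complex.I • X 1)).trace.re =
      (Zmat ρ X 0 0).re + (Zmat ρ X 1 1).re + 2 * (Zmat ρ X 0 1).im := by
    simp only [sub_mul, mul_add, smul_mul_assoc, mul_smul_comm, trace_add, trace_sub,
      trace_smul, hc, smul_eq_mul]
    simp [him 0 1]
    ring
  have h0 : ∀ j, (Zmat ρ X j j).im = 0 := fun j => by have := him j j; linarith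
  rw [hstar, h1, h2, holevoCost, traceNorm_antisymm (by simp [h0]) (by simp [h0])
    (by simp [him 0 1]), trace_fin_two]
  simp only [map_apply]
  rcases abs_cases (Zmat ρ X 0 1).im with ⟨e, h⟩ | ⟨e, h⟩
  · rw [e, max_eq_right (by linarith)]
  · rw [e, max_eq_left (by linarith)]; ring

theorem weightedForm_le_holevoCost (hρ : ρ.IsHermitian) {X : Fin 2 → Matrix (Fin D) (Fin D) ℂ}
    (hX : ∀ j, (X j).IsHermitian) {u : ℝ} (hu0 : 0 ≤ u) (hu1 : u ≤ 1) :
    weightedForm ρ u (X 0 + Complex.I • X 1) (X 0 + Complex.I • X 1) ≤ holevoCost ρ X := by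
  rw [holevoCost_eq_max hρ hX, weightedForm]
  have h1 := mul_le_mul_of_nonneg_left (le_max_left
    ((X 0 + Complex.I • X 1) * ρ * (X 0 + Complex.I • X 1)ᴴ).trace.re
    ((X 0 + Complex.I • X 1)ᴴ * ρ * (X 0 + Complex.I • X 1)).trace.re) hu0
  have h2 := mul_le_mul_of_nonneg_left (le_max_right
    ((X 0 + Complex.I • X 1) * ρ * (X 0 + Complex.I • X 1)ᴴ).trace.re
    ((X 0 + Complex.I • X 1)ᴴ * ρ * (X 0 + Complex.I • X 1)).trace.re) (sub_nonneg.2 hu1)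
  linarith

theorem trace_mul_im_eq_zero {A B : Matrix (Fin D) (Fin D) ℂ} (hA : A.IsHermitian)
    (hB : B.IsHermitian) : (A * B).trace.im = 0 := by
  have h : star (A * B).trace = (A * B).trace := by
    rw [← trace_conjTranspose, conjTranspose_mul, hA.eq, hB.eq, trace_mul_comm]
  exact Complex.conj_eq_iff_im.1 h

theorem locallyUnbiased_iff {ρ' : Fin 2 → Matrix (Fin D) (Fin D) ℂ}
    (hR : ∀ l, (triple ρ ρ' l).IsHermitian) (X : Fin 2 → Matrix (Fin D) (Fin D) ℂ) :
    LocallyUnbiased ρ ρ' X ↔ (∀ j, (X j).IsHermitian) ∧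
      constraintVec (triple ρ ρ') (X 0 + Complex.I • X 1) = bvec := by
  refine and_congr_right fun hX => ?_
  have hre : ∀ l, (triple ρ ρ' l * (X 0 + Complex.I • X 1)).trace.re =
      (triple ρ ρ' l * X 0).trace.re := fun l => by
    simp [mul_add, trace_mul_im_eq_zero (hR l) (hX 1)]
  have him : ∀ l, (triple ρ ρ' l * (X 0 + Complex.I • X 1)).trace.im =
      (triple ρ ρ' l * X 1).trace.re := fun l => by
    simp [mul_add, trace_mul_im_eq_zero (hR l) (hX 0)]
  have hval : ∀ l j (c : ℝ), (triple ρ ρ' l * X j).trace = c ↔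
      (triple ρ ρ' l * X j).trace.re = c := fun l j c => by
    rw [Complex.ext_iff, trace_mul_im_eq_zero (hR l) (hX j)]
    simp
  have h0 : ∀ j, (ρ * X j).trace = 0 ↔ (triple ρ ρ' 0 * X j).trace.re = 0 := fun j => by
    rw [← hval]; simp [triple]
  have h1 : ∀ j k, (ρ' j * X k).trace = (if j = k then 1 else 0) ↔
      (triple ρ ρ' j.succ * X k).trace.re = if j = k then 1 else 0 := fun j k => by
    have e : triple ρ ρ' j.succ = ρ' j := by fin_cases j <;> rfl
    rw [← hval, e]
    split_ifs <;> simp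
  simp only [h0, h1, funext_iff, Sum.forall, constraintVec, bvec, Sum.elim_inl, Sum.elim_inr, hre,
    him]
  simp only [Fin.forall_fin_succ]
  simp
  tauto

end Cost

/-! ### Attainment of the minimum -/

section Attained
variable {D : ℕ} {ρ U : Matrix (Fin D) (Fin D) ℂ} {p : Fin D → ℝ}

theorem exists_pos_sub_smul_one_posSemidef (hU : U ∈ Matrix.unitaryGroup (Fin D) ℂ)
    (hspec : ρ = U * diagonal (fun j => (p j : ℂ)) * Uᴴ) (hp : ∀ j, 0 < p j) :
    ∃ c : ℝ, 0 < c ∧ (ρ - (c : ℂ) • (1 : Matrix (Fin D) (Fin D) ℂ)).PosSemidef := by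
  have hev : ∀ᶠ c in 𝓝[>] (0 : ℝ), ∀ j, c < p j :=
    Filter.eventually_all.2 fun j => nhdsWithin_le_nhds (eventually_lt_nhds (hp j))
  obtain ⟨c, hc, hc0⟩ := (hev.and self_mem_nhdsWithin).exists
  refine ⟨c, hc0, ?_⟩
  have h1 : U * Uᴴ = 1 := mem_unitaryGroup_iff.1 hU
  have h2 : ρ - (c : ℂ) • (1 : Matrix (Fin D) (Fin D) ℂ) =
      U * diagonal (fun j => ((p j - c : ℝ) : ℂ)) * Uᴴ := by
    have : diagonal (fun j => ((p j - c : ℝ) : ℂ)) =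
        diagonal (fun j => (p j : ℂ)) - (c : ℂ) • (1 : Matrix (Fin D) (Fin D) ℂ) := by
      rw [smul_one_eq_diagonal, diagonal_sub]
      simp
    rw [this, mul_sub, sub_mul, ← hspec, mul_smul_comm, smul_mul_assoc, mul_one, h1]
  rw [h2]
  refine PosSemidef.mul_mul_conjTranspose_same (posSemidef_diagonal_iff.2 fun j => ?_) U
  exact_mod_cast (sub_pos.2 (hc j)).le

theorem norm_sq_entry_le_trace (X : Matrix (Fin D) (Fin D) ℂ) (a b : Fin D) :
    ‖X a b‖ ^ 2 ≤ (Xᴴ * X).trace.re := by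
  have h : (Xᴴ * X).trace.re = ∑ j, ∑ i, ‖X i j‖ ^ 2 := by
    simp only [trace, diag_apply, mul_apply, conjTranspose_apply, Complex.re_sum]
    refine Finset.sum_congr rfl fun j _ => Finset.sum_congr rfl fun i _ => ?_
    rw [← Complex.normSq_eq_norm_sq, Complex.normSq_apply]
    simp
  rw [h]
  exact (Finset.single_le_sum (f := fun i => ‖X i b‖ ^ 2) (fun i _ => by positivity)
    (Finset.mem_univ a)).trans (Finset.single_le_sum (f := fun j => ∑ i, ‖X i j‖ ^ 2)
      (fun i _ => by positivity) (Finset.mem_univ b))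

theorem mul_norm_sq_entry_le_trace {c : ℝ} (hc0 : 0 ≤ c)
    (hc : (ρ - (c : ℂ) • (1 : Matrix (Fin D) (Fin D) ℂ)).PosSemidef)
    (X : Matrix (Fin D) (Fin D) ℂ) (a b : Fin D) :
    c * ‖X a b‖ ^ 2 ≤ (Xᴴ * ρ * X).trace.re := by
  have h := (Complex.le_def.1 (hc.conjTranspose_mul_mul_same X).trace_nonneg).1
  rw [mul_sub, sub_mul, mul_smul_comm, smul_mul_assoc, mul_one, trace_sub, trace_smul,
    smul_eq_mul, Complex.sub_re, Complex.re_ofReal_mul] at h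
  have h1 := mul_le_mul_of_nonneg_left (norm_sq_entry_le_trace X a b) hc0
  simp only [Complex.zero_re] at h
  linarith

/-- Coercivity of the objective. -/
theorem mul_norm_sq_entry_le_holevoCost {d : ℕ} {c : ℝ} (hc0 : 0 ≤ c)
    (hc : (ρ - (c : ℂ) • (1 : Matrix (Fin D) (Fin D) ℂ)).PosSemidef) (hρ : ρ.PosSemidef)
    {X : Fin d → Matrix (Fin D) (Fin D) ℂ} (hX : ∀ j, (X j).IsHermitian) (j : Fin d)
    (a b : Fin D) : c * ‖X j a b‖ ^ 2 ≤ holevoCost ρ X := by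
  have e : ∀ i, (Zmat ρ X i i).re = ((X i)ᴴ * ρ * X i).trace.re := fun i => by
    rw [Zmat, of_apply, (hX i).eq, mul_assoc, trace_mul_comm, mul_assoc, trace_mul_comm (X i * ρ)]
  have h0 : ∀ i, 0 ≤ (Zmat ρ X i i).re := fun i => by
    rw [e]
    exact (Complex.le_def.1 (hρ.conjTranspose_mul_mul_same (X i)).trace_nonneg).1
  have h1 : 0 ≤ traceNorm ((Zmat ρ X).map Complex.im) :=
    Finset.sum_nonneg fun i _ => Real.sqrt_nonneg _
  have h2 : (Zmat ρ X j j).re ≤ ((Zmat ρ X).map Complex.re).trace :=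
    Finset.single_le_sum (f := fun i => (Zmat ρ X i i).re) (fun i _ => h0 i) (Finset.mem_univ j)
  have h3 := mul_norm_sq_entry_le_trace hc0 hc (X j) a b
  rw [← e] at h3
  rw [holevoCost]
  linarith

theorem isClosed_setOf_locallyUnbiased {d : ℕ} (ρ : Matrix (Fin D) (Fin D) ℂ)
    (ρ' : Fin d → Matrix (Fin D) (Fin D) ℂ) : IsClosed {X | LocallyUnbiased ρ ρ' X} := by
  have hX : ∀ j, Continuous fun X : Fin d → Matrix (Fin D) (Fin D) ℂ => X j :=
    fun j => continuous_apply j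
  simp only [LocallyUnbiased, Set.ofPred_and, Set.ofPred_forall]
  refine IsClosed.inter (isClosed_iInter fun j => ?_) (IsClosed.inter (isClosed_iInter fun j => ?_)
    (isClosed_iInter fun j => isClosed_iInter fun k => ?_))
  · exact isClosed_eq (hX j).matrix_conjTranspose (hX j)
  · exact isClosed_eq (continuous_const.matrix_mul (hX j)).matrix_trace continuous_const
  · exact isClosed_eq (continuous_const.matrix_mul (hX k)).matrix_trace continuous_const

/-- The objective is continuous and coercive on the closed feasible set, so that it attains its
minimum. -/
theorem isLeast_holevoBound (hU : U ∈ Matrix.unitaryGroup (Fin D) ℂ)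
    (hspec : ρ = U * diagonal (fun j => (p j : ℂ)) * Uᴴ) (hp : ∀ j, 0 < p j)
    (hρ : ρ.PosDef) {ρ' : Fin 2 → Matrix (Fin D) (Fin D) ℂ}
    {X₀ : Fin 2 → Matrix (Fin D) (Fin D) ℂ} (hX₀ : LocallyUnbiased ρ ρ' X₀) :
    IsLeast (holevoValues ρ ρ') (holevoBound ρ ρ') := by
  obtain ⟨c, hc0, hc⟩ := exists_pos_sub_smul_one_posSemidef hU hspec hp
  set g : (Fin 2 → Matrix (Fin D) (Fin D) ℂ) → ℝ := fun X => max
      ((X 0 + Complex.I • X 1) * ρ * (X 0 + Complex.I • X 1)ᴴ).trace.re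
      ((X 0 + Complex.I • X 1)ᴴ * ρ * (X 0 + Complex.I • X 1)).trace.re
  have hgc : Continuous g := by fun_prop
  have hcost : ∀ X, LocallyUnbiased ρ ρ' X → holevoCost ρ X = g X := fun X hX =>
    holevoCost_eq_max hρ.isHermitian hX.1
  set K : Set (Fin 2 → Matrix (Fin D) (Fin D) ℂ) :=
    {X | LocallyUnbiased ρ ρ' X} ∩ {X | g X ≤ g X₀}
  have hKc : IsCompact K := by
    have hcpt : IsCompact (Set.univ.pi fun _ : Fin 2 => Set.univ.pi fun _ : Fin D =>
        Set.univ.pi fun _ : Fin D => Metric.closedBall (0 : ℂ) (√(g X₀ / c))) :=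
      isCompact_univ_pi fun _ => isCompact_univ_pi fun _ => isCompact_univ_pi fun _ =>
        isCompact_closedBall _ _
    refine hcpt.of_isClosed_subset ((isClosed_setOf_locallyUnbiased ρ ρ').inter
      (isClosed_le hgc continuous_const)) fun X hX j _ a _ b _ => ?_
    rw [mem_closedBall_zero_iff]
    refine Real.le_sqrt_of_sq_le ((le_div_iff₀' hc0).2 ?_)
    refine (mul_norm_sq_entry_le_holevoCost hc0.le hc hρ.posSemidef hX.1.1 j a b).trans ?_
    rw [hcost X hX.1]
    exact hX.2
  obtain ⟨X, hXK, hmin⟩ := hKc.exists_isMinOn ⟨X₀, hX₀, le_refl (g X₀)⟩ hgc.continuousOn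
  have hleast : IsLeast (holevoValues ρ ρ') (holevoCost ρ X) := by
    refine ⟨⟨X, hXK.1, rfl⟩, ?_⟩
    rintro _ ⟨W, hW, rfl⟩
    rw [hcost X hXK.1, hcost W hW]
    rcases le_total (g W) (g X₀) with h | h
    · exact hmin ⟨hW, h⟩
    · exact hXK.2.trans h
  rw [holevoBound, hleast.csInf_eq]
  exact hleast

end Attained

/-! ### Derivatives of matrix curves -/

section Derivative

/-- Partial derivatives of a family that is Hermitian near `θ` are Hermitian: compare the
derivatives of the entry `(a, b)` and of the conjugate of the entry `(b, a)`. -/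
theorem HasPartialDerivAt.isHermitian {D d : ℕ} {ρ : (Fin d → ℝ) → Matrix (Fin D) (Fin D) ℂ}
    {j : Fin d} {M : Matrix (Fin D) (Fin D) ℂ} {θ : Fin d → ℝ}
    (h : HasPartialDerivAt ρ j M θ) (hρ : ∀ᶠ θ' in 𝓝 θ, (ρ θ').IsHermitian) : M.IsHermitian := by
  ext a b
  have hc : Filter.Tendsto (fun t => Function.update θ j t) (𝓝 (θ j)) (𝓝 θ) := by
    have : ContinuousAt (fun t => Function.update θ j t) (θ j) :=
      (continuous_const.update j continuous_id).continuousAt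
    simpa [ContinuousAt] using this
  have hs : HasDerivAt (fun t : ℝ => star (ρ (Function.update θ j t) b a)) (star (M b a)) (θ j) :=
    (h b a).star
  have he : (fun t : ℝ => star (ρ (Function.update θ j t) b a)) =ᶠ[𝓝 (θ j)]
      fun t => ρ (Function.update θ j t) a b := by
    filter_upwards [hc.eventually hρ] with t ht
    exact ht.apply a b
  exact (hs.congr_of_eventuallyEq he.symm).unique (h a b)

/-- The derivative of `v ⬝ᵥ Q⁻¹ w` along a curve of matrices, for entrywise derivatives: the
difference quotient of `Q⁻¹` is `-Q(s)⁻¹ ((Q(s) - Q(u)) / (s - u)) Q(u)⁻¹`. -/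
theorem hasDerivAt_dotProduct_inv_mulVec {n : Type*} [Fintype n] [DecidableEq n]
    {Q : ℝ → Matrix n n ℝ} {Q' : Matrix n n ℝ} {u : ℝ}
    (hQ : ∀ i j, HasDerivAt (fun s => Q s i j) (Q' i j) u) (hdet : (Q u).det ≠ 0) (v w : n → ℝ) :
    HasDerivAt (fun s => v ⬝ᵥ ((Q s)⁻¹ *ᵥ w)) (-(v ⬝ᵥ (((Q u)⁻¹ * Q' * (Q u)⁻¹) *ᵥ w))) u := by
  have hcont : ContinuousAt Q u :=
    continuousAt_pi.2 fun i => continuousAt_pi.2 fun j => (hQ i j).continuousAt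
  have hcdet : ContinuousAt (fun s => (Q s).det) u :=
    (continuous_id.matrix_det.continuousAt (x := Q u)).comp hcont
  have hne : ∀ᶠ s in 𝓝 u, (Q s).det ≠ 0 := hcdet.eventually_ne hdet
  have hinv : ContinuousAt (fun s => (Q s)⁻¹) u := by
    refine ContinuousAt.comp (g := Inv.inv) (continuousAt_matrix_inv _ ?_) hcont
    rw [Ring.inverse_eq_inv']
    exact continuousAt_inv₀ hdet
  have hslope : Filter.Tendsto (fun s => (s - u)⁻¹ • (Q s - Q u)) (𝓝[≠] u) (𝓝 Q') :=
    tendsto_pi_nhds.2 fun i => tendsto_pi_nhds.2 fun j =>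
      hasDerivAt_iff_tendsto_slope.1 (hQ i j)
  rw [hasDerivAt_iff_tendsto_slope]
  have hcts : Continuous fun M : Matrix n n ℝ × Matrix n n ℝ =>
      -(v ⬝ᵥ ((M.1 * M.2 * (Q u)⁻¹) *ᵥ w)) := by fun_prop
  have hlim := (hcts.tendsto ((Q u)⁻¹, Q')).comp
    ((hinv.tendsto.mono_left nhdsWithin_le_nhds).prodMk_nhds hslope)
  refine hlim.congr' ?_
  filter_upwards [nhdsWithin_le_nhds hne] with s hs
  have hi : (Q s)⁻¹ - (Q u)⁻¹ = -((Q s)⁻¹ * (Q s - Q u) * (Q u)⁻¹) := by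
    rw [mul_sub, sub_mul, nonsing_inv_mul _ (isUnit_iff_ne_zero.2 hs), one_mul, mul_assoc,
      mul_nonsing_inv _ (isUnit_iff_ne_zero.2 hdet), mul_one, neg_sub]
  rw [slope_def_module, ← dotProduct_sub, ← sub_mulVec, hi]
  simp [smul_mulVec, neg_mulVec]

end Derivative

/-! ### The bounds, their derivative and the optimal observables -/

section Bounds
variable {D : ℕ} {U : Matrix (Fin D) (Fin D) ℂ} {p : Fin D → ℝ}
  {R : Fin 3 → Matrix (Fin D) (Fin D) ℂ} {u : ℝ}

theorem trace_re_conjTranspose_swap {ρ : Matrix (Fin D) (Fin D) ℂ} (hρ : ρ.IsHermitian)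
    (Y W : Matrix (Fin D) (Fin D) ℂ) : (Y * ρ * Wᴴ).trace.re = (W * ρ * Yᴴ).trace.re := by
  have : (Y * ρ * Wᴴ)ᴴ = W * ρ * Yᴴ := by
    rw [conjTranspose_mul, conjTranspose_mul, conjTranspose_conjTranspose, hρ.eq, mul_assoc]
  rw [← this, trace_conjTranspose]
  simp

theorem weightedForm_comm {ρ : Matrix (Fin D) (Fin D) ℂ} (hρ : ρ.IsHermitian)
    (Y W : Matrix (Fin D) (Fin D) ℂ) : weightedForm ρ u Y W = weightedForm ρ u W Y := by
  rw [weightedForm, weightedForm, trace_re_conjTranspose_swap hρ]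
  have := trace_re_conjTranspose_swap hρ Yᴴ Wᴴ
  rw [conjTranspose_conjTranspose, conjTranspose_conjTranspose] at this
  rw [this]

/-- The weighted form is positive semidefinite, here evaluated at `W - Y`. -/
theorem two_mul_weightedForm_sub_le {ρ : Matrix (Fin D) (Fin D) ℂ} (hρ : ρ.PosSemidef)
    (hu0 : 0 ≤ u) (hu1 : u ≤ 1) (Y W : Matrix (Fin D) (Fin D) ℂ) :
    2 * weightedForm ρ u Y W - weightedForm ρ u Y Y ≤ weightedForm ρ u W W := by
  have h1 := (Complex.le_def.1 (hρ.mul_mul_conjTranspose_same (W - Y)).trace_nonneg).1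
  have h2 := (Complex.le_def.1 (hρ.conjTranspose_mul_mul_same (W - Y)).trace_nonneg).1
  have h3 : 0 ≤ weightedForm ρ u (W - Y) (W - Y) :=
    add_nonneg (mul_nonneg hu0 h1) (mul_nonneg (sub_nonneg.2 hu1) h2)
  have h4 : weightedForm ρ u (W - Y) (W - Y) = weightedForm ρ u W W - weightedForm ρ u W Y
      - weightedForm ρ u Y W + weightedForm ρ u Y Y := by
    simp only [weightedForm, conjTranspose_sub, sub_mul, mul_sub, trace_sub, Complex.sub_re]
    ring
  rw [h4, weightedForm_comm hρ.isHermitian W Y] at h3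
  linarith

/-- `𝓤_u` is the objective at the observables read off from `Y(z)`, `z = ½ 𝒬⁻¹ b`. -/
theorem upperBound_eq (hsymm : (calQ R U p u).IsHermitian) :
    upperBound R U p u = max
      (solY R U p u (optZ R U p u) * R 0 * (solY R U p u (optZ R U p u))ᴴ).trace.re
      ((solY R U p u (optZ R U p u))ᴴ * R 0 * solY R U p u (optZ R U p u)).trace.re := by
  have ht : ((calQ R U p u)⁻¹)ᵀ = (calQ R U p u)⁻¹ := by
    rw [transpose_nonsing_inv, ← conjTranspose_eq_transpose_of_trivial, hsymm.eq]
  have key : ∀ M : Matrix (Fin 3 ⊕ Fin 3) (Fin 3 ⊕ Fin 3) ℝ,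
      optZ R U p u ⬝ᵥ (M *ᵥ optZ R U p u) =
        1 / 4 * (bvec ⬝ᵥ (((calQ R U p u)⁻¹ * M * (calQ R U p u)⁻¹) *ᵥ bvec)) := fun M => by
    rw [optZ, mulVec_smul, dotProduct_smul, smul_dotProduct, mul_assoc, ← mulVec_mulVec,
      ← mulVec_mulVec, dotProduct_mulVec bvec, ← mulVec_transpose, ht, smul_eq_mul, smul_eq_mul]
    ring
  rw [← dotProduct_Q1, ← dotProduct_Q2, key, key, upperBound, mul_max_of_nonneg _ _ (by norm_num)]

theorem differentiableAt_gam_apply (hp : ∀ j, 0 < p j) (hu0 : 0 < u) (hu1 : u < 1) (l : Fin 3)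
    (a b : Fin D) : DifferentiableAt ℝ (fun s => gam R U p s l a b) u := by
  have hinv : ∀ j k, DifferentiableAt ℝ
      (fun s : ℝ => ((s * p k + (1 - s) * p j : ℝ) : ℂ)⁻¹) u := fun j k => by
    have h0 : DifferentiableAt ℝ (fun s : ℝ => s * p k + (1 - s) * p j) u := by fun_prop
    have h1 : DifferentiableAt ℝ (fun s : ℝ => ((s * p k + (1 - s) * p j : ℝ) : ℂ)) u :=
      Complex.ofRealCLM.differentiableAt.comp u h0
    exact h1.inv (by exact_mod_cast (weight_pos hp hu0 hu1 j k).ne')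
  simp only [gam, Matrix.neg_apply, mul_apply, of_apply]
  fun_prop

theorem varrho1_isHermitian (hR : ∀ l, (R l).IsHermitian) : (varrho1 R U p u).IsHermitian := by
  rw [varrho1, IsHermitian, conjTranspose_sum]
  exact Finset.sum_congr rfl fun l _ => by rw [conjTranspose_smul, (hR l).eq]; simp

theorem varrho4_isHermitian (hR : ∀ l, (R l).IsHermitian) : (varrho4 R U p u).IsHermitian := by
  rw [varrho4, IsHermitian, conjTranspose_sum]
  exact Finset.sum_congr rfl fun l _ => by rw [conjTranspose_smul, (hR l).eq]; simp

theorem denom_comm (j k : Fin D) : denom p u k j = denom p u j k := by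
  rw [denom, denom]
  congr 1
  ring

theorem obs1_isHermitian (hR : ∀ l, (R l).IsHermitian) : (obs1 R U p u).IsHermitian := by
  have h1 := fun j k => (isHermitian_conjTranspose_mul_mul U
    (varrho1_isHermitian (U := U) (p := p) (u := u) hR)).apply j k
  have h4 := fun j k => (isHermitian_conjTranspose_mul_mul U
    (varrho4_isHermitian (U := U) (p := p) (u := u) hR)).apply j k
  refine isHermitian_mul_mul_conjTranspose U (IsHermitian.ext fun j k => ?_)
  simp only [of_apply, denom_comm j k, star_div₀, star_sub, star_mul', h1, h4]
  simp [denom]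
  ring

theorem obs2_isHermitian (hR : ∀ l, (R l).IsHermitian) : (obs2 R U p u).IsHermitian := by
  have h1 := fun j k => (isHermitian_conjTranspose_mul_mul U
    (varrho1_isHermitian (U := U) (p := p) (u := u) hR)).apply j k
  have h4 := fun j k => (isHermitian_conjTranspose_mul_mul U
    (varrho4_isHermitian (U := U) (p := p) (u := u) hR)).apply j k
  refine isHermitian_mul_mul_conjTranspose U (IsHermitian.ext fun j k => ?_)
  simp only [of_apply, denom_comm j k, star_neg, star_div₀, star_add, star_mul', h1, h4]
  simp [denom]
  ring

/-- A full-rank spectral decomposition `R 0 = ∑ p_j |e_j⟩⟨e_j|` together with the Hermitian matrices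
`R 1`, `R 2`. -/
structure SpectralData (R : Fin 3 → Matrix (Fin D) (Fin D) ℂ) (U : Matrix (Fin D) (Fin D) ℂ)
    (p : Fin D → ℝ) : Prop where
  unitary : U ∈ Matrix.unitaryGroup (Fin D) ℂ
  spec : R 0 = U * diagonal (fun j => (p j : ℂ)) * Uᴴ
  posDef : (R 0).PosDef
  hermitian : ∀ l, (R l).IsHermitian

namespace SpectralData

theorem pos (h : SpectralData R U p) (j : Fin D) : 0 < p j :=
  eigenvalue_pos h.unitary h.spec h.posDef j

theorem weightedForm_solY (h : SpectralData R U p) (hu0 : 0 < u) (hu1 : u < 1)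
    (z : Fin 3 ⊕ Fin 3 → ℝ) (W : Matrix (Fin D) (Fin D) ℂ) :
    weightedForm (R 0) u (solY R U p u z) W = -(1 / 2) * (z ⬝ᵥ constraintVec R W) :=
  weightedForm_of_sylvester ((sylvester_iff h.unitary h.spec h.pos h.hermitian hu0 hu1 z _).2 rfl)
    h.posDef.isHermitian W

/-- The quadratic part `u Re 𝒬₁ + (1 - u) Re 𝒬₂` of `𝒬` equals `-½ Re 𝒬₃`, by the Sylvester
equation; so `𝒬` is half the matrix of the constraint functionals on the `Y(z)`. -/
theorem calQ_mulVec (h : SpectralData R U p) (hu0 : 0 < u) (hu1 : u < 1)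
    (w : Fin 3 ⊕ Fin 3 → ℝ) :
    calQ R U p u *ᵥ w = (1 / 2 : ℝ) • constraintVec R (solY R U p u w) := by
  refine dotProduct_eq _ _ fun z => ?_
  have h1 := h.weightedForm_solY hu0 hu1 z (solY R U p u w)
  rw [weightedForm, ← dotProduct_Q1, ← dotProduct_Q2] at h1
  rw [dotProduct_comm, calQ, add_mulVec, add_mulVec, smul_mulVec, smul_mulVec, Q3_mulVec,
    dotProduct_add, dotProduct_add, dotProduct_smul, dotProduct_smul, smul_eq_mul, smul_eq_mul, h1,
    dotProduct_comm _ z, dotProduct_smul, smul_eq_mul]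
  ring

theorem calQ_apply (h : SpectralData R U p) (hu0 : 0 < u) (hu1 : u < 1) (i j : Fin 3 ⊕ Fin 3) :
    calQ R U p u i j = 1 / 2 * constraintVec R (solY R U p u (Pi.single j 1)) i := by
  have := congrFun (h.calQ_mulVec hu0 hu1 (Pi.single j 1)) i
  simpa using this

/-- The multipliers `z = ½ 𝒬⁻¹ b` give a feasible `Y(z)`. -/
theorem constraintVec_solY_optZ (h : SpectralData R U p) (hu0 : 0 < u) (hu1 : u < 1)
    (hdet : (calQ R U p u).det ≠ 0) :
    constraintVec R (solY R U p u (optZ R U p u)) = bvec := by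
  have h1 := h.calQ_mulVec hu0 hu1 (optZ R U p u)
  rw [optZ, mulVec_smul, mulVec_mulVec, mul_nonsing_inv _ (isUnit_iff_ne_zero.2 hdet),
    one_mulVec] at h1
  exact (smul_right_injective _ (by norm_num : (1 / 2 : ℝ) ≠ 0) h1).symm

/-- The optimiser has the same product `-½ z · b = 𝓛_u` with every feasible matrix, itself
included. -/
theorem weightedForm_optimal (h : SpectralData R U p) (hu0 : 0 < u) (hu1 : u < 1)
    {W : Matrix (Fin D) (Fin D) ℂ} (hW : constraintVec R W = bvec) :
    weightedForm (R 0) u (solY R U p u (optZ R U p u)) W = lowerBound R U p u := by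
  rw [h.weightedForm_solY hu0 hu1, hW, optZ, smul_dotProduct, dotProduct_comm, lowerBound,
    smul_eq_mul]
  ring

theorem lowerBound_le_weightedForm (h : SpectralData R U p) (hu0 : 0 < u) (hu1 : u < 1)
    (hdet : (calQ R U p u).det ≠ 0) {W : Matrix (Fin D) (Fin D) ℂ}
    (hW : constraintVec R W = bvec) : lowerBound R U p u ≤ weightedForm (R 0) u W W := by
  have h1 := two_mul_weightedForm_sub_le h.posDef.posSemidef hu0.le hu1.le
    (solY R U p u (optZ R U p u)) W
  rw [h.weightedForm_optimal hu0 hu1 hW,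
    h.weightedForm_optimal hu0 hu1 (h.constraintVec_solY_optZ hu0 hu1 hdet)] at h1
  linarith

theorem differentiableAt_calQ_apply (h : SpectralData R U p) (hu0 : 0 < u) (hu1 : u < 1)
    (i j : Fin 3 ⊕ Fin 3) : DifferentiableAt ℝ (fun s => calQ R U p s i j) u := by
  have hg := differentiableAt_gam_apply (R := R) (U := U) h.pos hu0 hu1
  -- Through `calQ_apply` only the linear dependence of `𝒬` on the `γ_l` is needed.
  have hev : (fun s => calQ R U p s i j) =ᶠ[𝓝 u]
      fun s => 1 / 2 * constraintVec R (solY R U p s (Pi.single j 1)) i := by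
    filter_upwards [Ioo_mem_nhds hu0 hu1] with s hs
    exact h.calQ_apply hs.1 hs.2 i j
  refine DifferentiableAt.congr_of_eventuallyEq (DifferentiableAt.const_mul ?_ _) hev
  have ht : ∀ l, DifferentiableAt ℝ
      (fun s => (R l * solY R U p s (Pi.single j 1)).trace) u := fun l => by
    simp only [trace, diag_apply, mul_apply, solY, Matrix.sum_apply, Matrix.smul_apply]
    fun_prop
  rcases i with l | l
  · exact Complex.reCLM.differentiableAt.comp u (ht l)
  · exact Complex.imCLM.differentiableAt.comp u (ht l)

theorem hasDerivAt_lowerBound (h : SpectralData R U p) (hu0 : 0 < u) (hu1 : u < 1)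
    (hdet : (calQ R U p u).det ≠ 0) :
    HasDerivAt (fun s => lowerBound R U p s) (1 / 4 * (bvec ⬝ᵥ (((calQ R U p u)⁻¹ *
      calQderiv R U p u * (calQ R U p u)⁻¹) *ᵥ bvec))) u := by
  have h1 := (hasDerivAt_dotProduct_inv_mulVec (Q' := calQderiv R U p u)
    (fun i j => (h.differentiableAt_calQ_apply hu0 hu1 i j).hasDerivAt) hdet bvec bvec).const_mul
    (-(1 / 4) : ℝ)
  exact h1.congr_deriv (by ring)

/-- Envelope argument: for the optimiser `Y` at `u`, the weighted form of `Y` is affine in the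
weight `s` and touches `𝓛_s` from above at `s = u`, so the two have the same derivative there. -/
theorem trace_eq_of_deriv_eq_zero (h : SpectralData R U p) (hu0 : 0 < u) (hu1 : u < 1)
    (hdet : (calQ R U p u).det ≠ 0) (hder : deriv (fun s => lowerBound R U p s) u = 0) :
    (solY R U p u (optZ R U p u) * R 0 * (solY R U p u (optZ R U p u))ᴴ).trace.re =
      ((solY R U p u (optZ R U p u))ᴴ * R 0 * solY R U p u (optZ R U p u)).trace.re := by
  set Y := solY R U p u (optZ R U p u)
  have hfeas : constraintVec R Y = bvec := h.constraintVec_solY_optZ hu0 hu1 hdet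
  have hne : ∀ᶠ s in 𝓝 u, (calQ R U p s).det ≠ 0 := by
    have hc : ContinuousAt (fun s => calQ R U p s) u := continuousAt_pi.2 fun i =>
      continuousAt_pi.2 fun j => (h.differentiableAt_calQ_apply hu0 hu1 i j).continuousAt
    have hcd : ContinuousAt (fun s => (calQ R U p s).det) u :=
      ContinuousAt.comp (g := Matrix.det) continuous_id.matrix_det.continuousAt hc
    exact hcd.eventually_ne hdet
  have hmin : IsLocalMin (fun s => weightedForm (R 0) s Y Y - lowerBound R U p s) u := by
    filter_upwards [hne, Ioo_mem_nhds hu0 hu1] with s hs hs01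
    rw [h.weightedForm_optimal hu0 hu1 hfeas, sub_self]
    exact sub_nonneg.2 (h.lowerBound_le_weightedForm hs01.1 hs01.2 hs hfeas)
  have hL : HasDerivAt (fun s => lowerBound R U p s) 0 u := by
    rw [← hder]
    exact (h.hasDerivAt_lowerBound hu0 hu1 hdet).differentiableAt.hasDerivAt
  have hW : HasDerivAt (fun s => weightedForm (R 0) s Y Y)
      ((Y * R 0 * Yᴴ).trace.re - (Yᴴ * R 0 * Y).trace.re) u := by
    have := ((hasDerivAt_id u).mul_const (Y * R 0 * Yᴴ).trace.re).add
      (((hasDerivAt_id u).const_sub 1).mul_const (Yᴴ * R 0 * Y).trace.re)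
    exact this.congr_deriv (by ring)
  have := hmin.hasDerivAt_eq_zero (hW.sub hL)
  linarith

theorem obs1_add_I_smul_obs2 (h : SpectralData R U p) (hu0 : 0 < u) (hu1 : u < 1) :
    obs1 R U p u + Complex.I • obs2 R U p u = solY R U p u (optZ R U p u) := by
  rw [eq_iff_eigenbasis h.unitary]
  intro j k
  rw [solY_eigenbasis h.unitary, mul_add, add_mul, mul_smul_comm, smul_mul_assoc, obs1, obs2,
    conj_unconj h.unitary, conj_unconj h.unitary]
  have h1 : ((u * p k + (1 - u) * p j : ℝ) : ℂ) ≠ 0 := by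
    exact_mod_cast (weight_pos h.pos hu0 hu1 j k).ne'
  have h2 : ((u * p j + (1 - u) * p k : ℝ) : ℂ) ≠ 0 := by
    exact_mod_cast (weight_pos h.pos hu0 hu1 k j).ne'
  -- With `a` and `b` the two weights, the numerators only involve `a - b` and `a + b`.
  have hsub : (p j - p k) * (1 - 2 * u) =
      (u * p k + (1 - u) * p j) - (u * p j + (1 - u) * p k) := by ring
  have hadd : p j + p k = (u * p k + (1 - u) * p j) + (u * p j + (1 - u) * p k) := by ring
  have hv : ∑ l, ((optZ R U p u (.inl l) : ℂ) + Complex.I * (optZ R U p u (.inr l) : ℂ)) / 2 *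
      (Uᴴ * R l * U) j k =
      ((Uᴴ * varrho1 R U p u * U) j k + Complex.I * (Uᴴ * varrho4 R U p u * U) j k) / 2 := by
    simp only [varrho1, varrho4, Finset.mul_sum, Finset.sum_mul, Matrix.sum_apply, mul_smul_comm,
      smul_mul_assoc, Matrix.smul_apply, smul_eq_mul, ← Finset.sum_add_distrib, Finset.sum_div]
    refine Finset.sum_congr rfl fun l _ => ?_
    ring
  rw [hv]
  simp only [Matrix.add_apply, Matrix.smul_apply, of_apply, smul_eq_mul, denom, hsub, hadd]
  generalize (Uᴴ * varrho1 R U p u * U) j k = x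
  generalize (Uᴴ * varrho4 R U p u * U) j k = y
  generalize u * p k + (1 - u) * p j = a at h1 ⊢
  generalize u * p j + (1 - u) * p k = b at h2 ⊢
  push_cast
  field_simp
  linear_combination (-2 * (a - b) * x) * Complex.I_sq

end SpectralData
end Bounds

end HCRB

theorem theorem3 {D : ℕ}
    -- a two-parameter model of states near `θ`, of full rank at `θ`, with partial derivatives `ρ'`
    (ρ : (Fin 2 → ℝ) → Matrix (Fin D) (Fin D) ℂ) (θ : Fin 2 → ℝ)
    (hstate : ∀ᶠ θ' in 𝓝 θ, HCRB.IsDensityMatrix (ρ θ'))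
    (hfull : (ρ θ).PosDef)
    (ρ' : Fin 2 → Matrix (Fin D) (Fin D) ℂ)
    (hderiv : ∀ j, HCRB.HasPartialDerivAt ρ j (ρ' j) θ)
    -- a spectral decomposition of `ρ θ`
    (U : Matrix (Fin D) (Fin D) ℂ) (hU : U ∈ Matrix.unitaryGroup (Fin D) ℂ) (p : Fin D → ℝ)
    (hspec : ρ θ = U * Matrix.diagonal (fun j => (p j : ℂ)) * Uᴴ)
    (R : Fin 3 → Matrix (Fin D) (Fin D) ℂ) (hR : R = HCRB.triple (ρ θ) ρ')
    (u : ℝ) (hu0 : 0 < u) (hu1 : u < 1)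
    -- `𝒬` is negative definite, and therefore of full rank
    (hQ : (-(HCRB.calQ R U p u)).PosDef) :
    -- `solY` is the unique solution of the Sylvester equation, for all multipliers `z`
    (∀ (z : Fin 3 ⊕ Fin 3 → ℝ) (Y : Matrix (Fin D) (Fin D) ℂ),
      (u : ℂ) • (Y * ρ θ) + ((1 - u : ℝ) : ℂ) • (ρ θ * Y) = -(HCRB.lagrangeA R z)ᴴ ↔
        Y = HCRB.solY R U p u z) ∧
    -- the Holevo minimisation is feasible and its minimum `C_H` is attained
    IsLeast (HCRB.holevoValues (ρ θ) ρ') (HCRB.holevoBound (ρ θ) ρ') ∧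
    -- the two bounds
    HCRB.lowerBound R U p u ≤ HCRB.holevoBound (ρ θ) ρ' ∧
    HCRB.holevoBound (ρ θ) ρ' ≤ HCRB.upperBound R U p u ∧
    -- the derivative of the lower bound
    (∀ i j, DifferentiableAt ℝ (fun s => HCRB.calQ R U p s i j) u) ∧
    HasDerivAt (fun s => HCRB.lowerBound R U p s)
      (1 / 4 * (HCRB.bvec ⬝ᵥ (((HCRB.calQ R U p u)⁻¹ * HCRB.calQderiv R U p u *
        (HCRB.calQ R U p u)⁻¹) *ᵥ HCRB.bvec))) u ∧
    -- at a stationary point the bounds are equalities, and `X₁`, `X₂` are optimal observables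
    (deriv (fun s => HCRB.lowerBound R U p s) u = 0 →
      HCRB.lowerBound R U p u = HCRB.holevoBound (ρ θ) ρ' ∧
      HCRB.holevoBound (ρ θ) ρ' = HCRB.upperBound R U p u ∧
      HCRB.LocallyUnbiased (ρ θ) ρ' ![HCRB.obs1 R U p u, HCRB.obs2 R U p u] ∧
      HCRB.holevoCost (ρ θ) ![HCRB.obs1 R U p u, HCRB.obs2 R U p u] =
        HCRB.holevoBound (ρ θ) ρ' ∧
      HCRB.obs1 R U p u + Complex.I • HCRB.obs2 R U p u =
        HCRB.solY R U p u (HCRB.optZ R U p u)) := by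
  subst hR
  have hherm : ∀ j, (ρ' j).IsHermitian := fun j =>
    (hderiv j).isHermitian (hstate.mono fun _ h => h.1.isHermitian)
  have h : HCRB.SpectralData (HCRB.triple (ρ θ) ρ') U p := by
    refine ⟨hU, hspec, hfull, fun l => ?_⟩
    fin_cases l
    exacts [hfull.isHermitian, hherm 0, hherm 1]
  have hdet : (HCRB.calQ (HCRB.triple (ρ θ) ρ') U p u).det ≠ 0 := by
    have := hQ.isUnit
    rw [IsUnit.neg_iff, Matrix.isUnit_iff_isUnit_det, isUnit_iff_ne_zero] at this
    exact this
  have hsymm : (HCRB.calQ (HCRB.triple (ρ θ) ρ') U p u).IsHermitian := by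
    simpa using hQ.isHermitian.neg
  set Y := HCRB.solY (HCRB.triple (ρ θ) ρ') U p u (HCRB.optZ (HCRB.triple (ρ θ) ρ') U p u)
  have hfeas : HCRB.constraintVec (HCRB.triple (ρ θ) ρ') Y = HCRB.bvec :=
    h.constraintVec_solY_optZ hu0 hu1 hdet
  have hobs := h.obs1_add_I_smul_obs2 hu0 hu1
  set X : Fin 2 → Matrix (Fin D) (Fin D) ℂ :=
    ![HCRB.obs1 (HCRB.triple (ρ θ) ρ') U p u, HCRB.obs2 (HCRB.triple (ρ θ) ρ') U p u]
  have hXherm : ∀ j, (X j).IsHermitian := Fin.forall_fin_two.2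
    ⟨HCRB.obs1_isHermitian h.hermitian, HCRB.obs2_isHermitian h.hermitian⟩
  have hXY : X 0 + Complex.I • X 1 = Y := hobs
  have hX : HCRB.LocallyUnbiased (ρ θ) ρ' X :=
    (HCRB.locallyUnbiased_iff h.hermitian X).2 ⟨hXherm, by rw [hXY]; exact hfeas⟩
  have hleast := HCRB.isLeast_holevoBound hU hspec h.pos hfull hX
  have hcost : HCRB.holevoCost (ρ θ) X = HCRB.upperBound (HCRB.triple (ρ θ) ρ') U p u := by
    rw [HCRB.holevoCost_eq_max hfull.isHermitian hXherm, hXY,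
      HCRB.upperBound_eq hsymm]
    rfl
  have hupper : HCRB.holevoBound (ρ θ) ρ' ≤ HCRB.upperBound (HCRB.triple (ρ θ) ρ') U p u :=
    hcost ▸ hleast.2 ⟨X, hX, rfl⟩
  have hlower : HCRB.lowerBound (HCRB.triple (ρ θ) ρ') U p u ≤ HCRB.holevoBound (ρ θ) ρ' := by
    obtain ⟨W, hW, hWeq⟩ := hleast.1
    rw [← hWeq]
    exact (h.lowerBound_le_weightedForm hu0 hu1 hdet
      ((HCRB.locallyUnbiased_iff h.hermitian W).1 hW).2).trans
      (HCRB.weightedForm_le_holevoCost hfull.isHermitian hW.1 hu0.le hu1.le)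
  refine ⟨HCRB.sylvester_iff hU hspec h.pos h.hermitian hu0 hu1, hleast, hlower, hupper,
    h.differentiableAt_calQ_apply hu0 hu1, h.hasDerivAt_lowerBound hu0 hu1 hdet, fun hder => ?_⟩
  -- At a stationary point `Tr(Y ρ Y†) = Tr(Y† ρ Y)`, so the maximum equals the weighted mean.
  have heq : HCRB.lowerBound (HCRB.triple (ρ θ) ρ') U p u =
      HCRB.upperBound (HCRB.triple (ρ θ) ρ') U p u := by
    have h1 := h.trace_eq_of_deriv_eq_zero hu0 hu1 hdet hder
    rw [← h.weightedForm_optimal hu0 hu1 hfeas, HCRB.upperBound_eq hsymm, h1,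
      max_self, HCRB.weightedForm, h1]
    ring
  have hCH : HCRB.holevoBound (ρ θ) ρ' = HCRB.upperBound (HCRB.triple (ρ θ) ρ') U p u :=
    le_antisymm hupper (heq ▸ hlower)
  exact ⟨heq.trans hCH.symm, hCH, hX, hcost.trans hCH.symm, hobs⟩
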